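/- Let $F$ be a countable field. For a unital $F$-algebra $A$, let $M_{\mathbb N\times\mathbb N}(A)$ be the algebra of $\mathbb N\times\mathbb N$ matrices over $A$ ($\mathbb N=\{0,1,2,\dots\}$) with only finitely many nonzero entries, and let $\widetilde{M}=\widetilde{M_{\mathbb N\times\mathbb N}(A)}$ be the algebra of $\mathbb N\times\mathbb N$ matrices with only finitely many nonzero entries in each row and in each column; write $x_{i,j}$ for the matrix with $x$ in position $(i,j)$ and zeros elsewhere. Consider the associative algebra $F[t^{-1},t]+\widetilde M$, which as a vector space is the direct sum of the space of Laurent polynomials and $\widetilde M$, in which $\widetilde M$ is an ideal with its matrix multiplication, the elements $t^n$ and $(t^{-1})^n$, $n\ge 0$, are the powers of $t$ and of $t^{-1}$, and $$t^{-1}t=1,\quad tt^{-1}=1-1_{0,0},\quad t\,x_{i,j}=x_{i+1,j},\quad t^{-1}x_{i,j}=x_{i-1,j}\ (i\ge 1),\quad t^{-1}x_{0,j}=0,$$ $$x_{i,j}\,t=x_{i,j-1}\ (j\ge 1),\quad x_{i,0}\,t=0,\quad x_{i,j}\,t^{-1}=x_{i,j+1}$$ (and, accordingly, $t$ and $t^{-1}$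 act on all of $\widetilde M$ by shifting rows and columns). If $a_0,a_1,\dots$ generate $A$, let $B\subseteq F[t^{-1},t]+\widetilde M$ be the subalgebra generated by $t$, $t^{-1}$, $\sum_{i\ge 0}(a_i)_{i,i}$ and $1_{0,0}$. (1) In the field of rational functions $F(t)$ let $A_0=\{f/g : f,g\in F[t],\ f(0)=0,\ g(0)=1\}$. Then $A_0$ is a nonzero commutative domain (without $1$) that is equal to its Jacobson radical and has countable dimension over $F$, and the algebra $A=F\cdot 1+A_0$ is generated by some sequence $a_0,a_1,\dots$ such that the corresponding algebra $B$ is affine (finitely generated) and its Jacobson radical is not nil. (2) More generally, let $A_0$ be a nonzero domain, not necessarily with $1$, that is a non-unital subalgebra of a commutative unital $F$-algebra $R$ and is equal to its Jacobson radical, let $A=F\cdot 1+A_0\subseteq R$, and let $a_0,a_1,\dots$ be any sequence generating the algebra $A$. Then the algebra $B$ is affine, $F[t^{-1},t]+M_{\mathbb N\times\mathbb N}(A)\subseteq B$, the Jacobson radical of $B$ contains $M_{\mathbb N\times\mathbb N}(A_0)$, and the Jacobson radical of $B$ is not nil. In particular all this holds for the algebra $A_0$ of (1). -/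

import Mathlib

open Polynomial LaurentPolynomial

noncomputable section

namespace LoopWreath

/-! ### Infinite matrices -/

section Matrices

variable (F A : Type*) [Field F] [Ring A] [Algebra F A]

/-- The space of `ℕ × ℕ` matrices over `A` having only finitely many nonzero entries in each row
and in each column. -/
def rcfSubmodule : Submodule F (Matrix ℕ ℕ A) where
  carrier := {m | (∀ i, {j | m i j ≠ 0}.Finite) ∧ (∀ j, {i | m i j ≠ 0}.Finite)}
  zero_mem' := by simp
  add_mem' := by
    rintro m n ⟨h1, h2⟩ ⟨h3, h4⟩
    refine ⟨fun i => ((h1 i).union (h3 i)).subset ?_, fun j => ((h2 j).union (h4 j)).subset ?_⟩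
    · intro j hj
      by_contra hc
      simp only [Set.mem_union, Set.mem_ofPred, not_or, not_not] at hc
      exact hj (by rw [Matrix.add_apply, hc.1, hc.2, add_zero])
    · intro i hi
      by_contra hc
      simp only [Set.mem_union, Set.mem_ofPred, not_or, not_not] at hc
      exact hi (by rw [Matrix.add_apply, hc.1, hc.2, add_zero])
  smul_mem' := by
    rintro c m ⟨h1, h2⟩
    refine ⟨fun i => (h1 i).subset ?_, fun j => (h2 j).subset ?_⟩
    · intro j hj hc
      exact hj (by rw [Matrix.smul_apply, hc, smul_zero])
    · intro i hi hc
      exact hi (by rw [Matrix.smul_apply, hc, smul_zero])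

/-- The algebra of row- and column-finite `ℕ × ℕ` matrices over `A`. -/
def RCFMatrix : Type _ := rcfSubmodule F A

namespace RCFMatrix

instance : AddCommGroup (RCFMatrix F A) := inferInstanceAs (AddCommGroup (rcfSubmodule F A))
instance : Module F (RCFMatrix F A) := inferInstanceAs (Module F (rcfSubmodule F A))

variable {F A}

/-- The matrix underlying an element of `RCFMatrix F A`. -/
def entry (m : RCFMatrix F A) : Matrix ℕ ℕ A := m.1

theorem row_finite (m : RCFMatrix F A) (i : ℕ) : {j | m.entry i j ≠ 0}.Finite := m.2.1 i

theorem col_finite (m : RCFMatrix F A) (j : ℕ) : {i | m.entry i j ≠ 0}.Finite := m.2.2 j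

@[ext] theorem ext {m n : RCFMatrix F A} (h : ∀ i j, m.entry i j = n.entry i j) : m = n :=
  Subtype.ext (Matrix.ext h)

@[simp] theorem entry_zero (i j : ℕ) : (0 : RCFMatrix F A).entry i j = 0 := rfl

@[simp] theorem entry_add (m n : RCFMatrix F A) (i j : ℕ) :
    (m + n).entry i j = m.entry i j + n.entry i j := rfl

@[simp] theorem entry_neg (m : RCFMatrix F A) (i j : ℕ) :
    (-m).entry i j = -m.entry i j := rfl

@[simp] theorem entry_sub (m n : RCFMatrix F A) (i j : ℕ) :
    (m - n).entry i j = m.entry i j - n.entry i j := rfl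

@[simp] theorem entry_smul (c : F) (m : RCFMatrix F A) (i j : ℕ) :
    (c • m).entry i j = c • m.entry i j := rfl

theorem mul_mem (m n : RCFMatrix F A) :
    (fun i k => ∑ j ∈ (m.row_finite i).toFinset, m.entry i j * n.entry j k : Matrix ℕ ℕ A)
      ∈ rcfSubmodule F A := by
  refine ⟨fun i => ?_, fun k => ?_⟩
  · refine ((m.row_finite i).biUnion fun j _ => n.row_finite j).subset fun k hk => ?_
    obtain ⟨j, hj, hne⟩ := Finset.exists_ne_zero_of_sum_ne_zero hk
    simp only [Set.mem_iUnion]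
    exact ⟨j, by simpa using hj, right_ne_zero_of_mul hne⟩
  · refine ((n.col_finite k).biUnion fun j _ => m.col_finite j).subset fun i hi => ?_
    obtain ⟨j, hj, hne⟩ := Finset.exists_ne_zero_of_sum_ne_zero hi
    simp only [Set.mem_iUnion]
    exact ⟨j, right_ne_zero_of_mul hne, left_ne_zero_of_mul hne⟩

/-- The usual matrix product; the sums run over the finite row supports of the left factor. -/
instance : Mul (RCFMatrix F A) := ⟨fun m n => ⟨_, mul_mem m n⟩⟩

theorem one_mem : (1 : Matrix ℕ ℕ A) ∈ rcfSubmodule F A := by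
  refine ⟨fun i => (Set.finite_singleton i).subset fun j hj => ?_,
    fun j => (Set.finite_singleton j).subset fun i hi => ?_⟩
  · by_contra h
    exact hj (Matrix.one_apply_ne' h)
  · by_contra h
    exact hi (Matrix.one_apply_ne h)

instance : One (RCFMatrix F A) := ⟨⟨1, one_mem⟩⟩

@[simp] theorem entry_one (i j : ℕ) :
    (1 : RCFMatrix F A).entry i j = (1 : Matrix ℕ ℕ A) i j := rfl

theorem entry_mul (m n : RCFMatrix F A) (i k : ℕ) :
    (m * n).entry i k = ∑ j ∈ (m.row_finite i).toFinset, m.entry i j * n.entry j k := rfl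

theorem entry_mul_eq_sum (m n : RCFMatrix F A) (i k : ℕ) (s : Finset ℕ)
    (hs : ∀ j, m.entry i j ≠ 0 → n.entry j k ≠ 0 → j ∈ s) :
    (m * n).entry i k = ∑ j ∈ s, m.entry i j * n.entry j k := by
  classical
  rw [entry_mul]
  have h1 := Finset.sum_subset (f := fun j => m.entry i j * n.entry j k)
    (Finset.subset_union_left (s₁ := (m.row_finite i).toFinset) (s₂ := s)) (by
      intro j _ hj
      have : m.entry i j = 0 := by simpa using hj
      simp [this])
  have h2 := Finset.sum_subset (f := fun j => m.entry i j * n.entry j k)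
    (Finset.subset_union_right (s₁ := (m.row_finite i).toFinset) (s₂ := s)) (by
      intro j _ hj
      by_contra hc
      exact hj (hs j (left_ne_zero_of_mul hc) (right_ne_zero_of_mul hc)))
  exact h1.trans h2.symm

theorem entry_mul_eq_sum_left (m n : RCFMatrix F A) (i k : ℕ) (s : Finset ℕ)
    (hs : ∀ j, m.entry i j ≠ 0 → j ∈ s) :
    (m * n).entry i k = ∑ j ∈ s, m.entry i j * n.entry j k :=
  entry_mul_eq_sum m n i k s fun j h _ => hs j h

theorem entry_mul_eq_sum_right (m n : RCFMatrix F A) (i k : ℕ) (s : Finset ℕ)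
    (hs : ∀ j, n.entry j k ≠ 0 → j ∈ s) :
    (m * n).entry i k = ∑ j ∈ s, m.entry i j * n.entry j k :=
  entry_mul_eq_sum m n i k s fun j _ h => hs j h

instance : Ring (RCFMatrix F A) where
  __ := (inferInstance : AddCommGroup (RCFMatrix F A))
  left_distrib a b c := by
    ext i k
    simp only [entry_mul, entry_add, mul_add, Finset.sum_add_distrib]
  right_distrib a b c := by
    ext i k
    rw [entry_add]
    have h := fun (m : RCFMatrix F A) => entry_mul_eq_sum_right m c i k
      (c.col_finite k).toFinset (by simp)
    rw [h, h, h, ← Finset.sum_add_distrib]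
    simp only [entry_add, add_mul]
  zero_mul a := by
    ext i k
    rw [entry_mul_eq_sum_left 0 a i k ∅ (by simp)]
    simp
  mul_zero a := by
    ext i k
    simp [entry_mul]
  mul_assoc a b c := by
    ext i l
    rw [entry_mul_eq_sum_right (a * b) c i l (c.col_finite l).toFinset (by simp),
      entry_mul]
    have h := fun j => entry_mul_eq_sum_right b c j l (c.col_finite l).toFinset (by simp)
    simp only [h, entry_mul a b, Finset.sum_mul, Finset.mul_sum, mul_assoc]
    exact Finset.sum_comm
  one_mul a := by
    ext i k
    rw [entry_mul_eq_sum_left 1 a i k {i} (by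
      intro j hj
      by_contra h
      exact hj (Matrix.one_apply_ne' (by simpa using h)))]
    simp
  mul_one a := by
    ext i k
    rw [entry_mul_eq_sum_right a 1 i k {k} (by
      intro j hj
      by_contra h
      exact hj (Matrix.one_apply_ne (by simpa using h)))]
    simp

instance : Algebra F (RCFMatrix F A) := Algebra.ofModule
  (fun c m n => by
    ext i k
    rw [entry_mul_eq_sum_left (c • m) n i k (m.row_finite i).toFinset (by
      intro j hj
      simp only [Set.Finite.mem_toFinset, Set.mem_ofPred]
      intro hc
      exact hj (by rw [entry_smul, hc, smul_zero])), entry_smul, entry_mul, Finset.smul_sum]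
    simp)
  (fun c m n => by
    ext i k
    simp [entry_mul, Finset.smul_sum])

variable (F) in
/-- The matrix `x_{i,j}`, with `x` in row `i` and column `j` and zeros elsewhere. -/
def single (i j : ℕ) (x : A) : RCFMatrix F A :=
  ⟨Matrix.single i j x, by
    refine ⟨fun k => (Set.finite_singleton j).subset fun l hl => ?_,
      fun l => (Set.finite_singleton i).subset fun k hk => ?_⟩
    · by_contra h
      exact hl (Matrix.single_apply_of_ne _ _ _ _ _ fun hc => h hc.2.symm)
    · by_contra h
      exact hk (Matrix.single_apply_of_ne _ _ _ _ _ fun hc => h hc.1.symm)⟩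

variable (F) in
/-- The diagonal matrix `∑ i, (a i)_{i,i}`. -/
def diagonal (a : ℕ → A) : RCFMatrix F A :=
  ⟨Matrix.diagonal a, by
    refine ⟨fun i => (Set.finite_singleton i).subset fun j hj => ?_,
      fun j => (Set.finite_singleton j).subset fun i hi => ?_⟩
    · by_contra h
      exact hj (Matrix.diagonal_apply_ne' _ h)
    · by_contra h
      exact hi (Matrix.diagonal_apply_ne _ h)⟩

/-- The matrix has only finitely many nonzero entries, that is, it lies in `M_{ℕ×ℕ}(A)`. -/
def IsFinitary (m : RCFMatrix F A) : Prop :=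
  {p : ℕ × ℕ | m.entry p.1 p.2 ≠ 0}.Finite

end RCFMatrix

/-- The action of a Laurent polynomial `∑ cₙ tⁿ` on matrices: the matrix whose `(i,j)` entry is
`c_{i-j}`. Thus `t` acts by `x_{i,j} ↦ x_{i+1,j}`, and `t⁻¹` by `x_{i,j} ↦ x_{i-1,j}` for `1 ≤ i`
and `x_{0,j} ↦ 0`. -/
def toeplitz : F[T;T⁻¹] →ₗ[F] RCFMatrix F A where
  toFun l := ⟨fun i j => algebraMap F A (l.coeff ((i : ℤ) - j)), by
    have key : {n : ℤ | l.coeff n ≠ 0}.Finite :=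
      l.coeff.hasFiniteSupport
    refine ⟨fun i => (key.preimage (f := fun j : ℕ => (i : ℤ) - j) ?_).subset ?_,
      fun j => (key.preimage (f := fun i : ℕ => (i : ℤ) - j) ?_).subset ?_⟩
    · intro a _ b _ h
      simpa using h
    · intro j hj hc
      exact hj ((congrArg (algebraMap F A) hc).trans (map_zero _))
    · intro a _ b _ h
      simpa using h
    · intro i hi hc
      exact hi ((congrArg (algebraMap F A) hc).trans (map_zero _))⟩
  map_add' l l' := by
    ext i j
    exact map_add (algebraMap F A) _ _
  map_smul' c l := by
    ext i j
    exact (map_mul (algebraMap F A) _ _).trans (Algebra.smul_def _ _).symm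

@[simp] theorem entry_toeplitz (l : F[T;T⁻¹]) (i j : ℕ) :
    (toeplitz F A l).entry i j = algebraMap F A (l.coeff ((i : ℤ) - j)) := rfl

@[simp] theorem toeplitz_one : toeplitz F A 1 = 1 := by
  ext i j
  rw [entry_toeplitz, RCFMatrix.entry_one, ← LaurentPolynomial.T_zero, LaurentPolynomial.T]
  rcases eq_or_ne i j with rfl | h
  · simp
  · rw [Matrix.one_apply_ne h, AddMonoidAlgebra.coeff_single, Finsupp.single_eq_of_ne (by lia),
      map_zero]

end Matrices

/-! ### The algebra `F[t⁻¹,t] + M` -/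

section Ambient

variable (F A : Type*) [Field F] [Ring A] [Algebra F A]

/-- The algebra `F[t⁻¹,t] + M`, where `M` is the algebra of row- and column-finite `ℕ × ℕ` matrices
over `A`. As a vector space it is the direct sum of (a copy of) the space of Laurent polynomials
and of `M`. -/
def Ambient : Type _ := F[T;T⁻¹] × RCFMatrix F A

namespace Ambient

instance : AddCommGroup (Ambient F A) := inferInstanceAs (AddCommGroup (F[T;T⁻¹] × RCFMatrix F A))
instance : Module F (Ambient F A) := inferInstanceAs (Module F (F[T;T⁻¹] × RCFMatrix F A))

variable {F A}

/-- The element `l + m`. -/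
def mk (l : F[T;T⁻¹]) (m : RCFMatrix F A) : Ambient F A := (l, m)

/-- The Laurent polynomial component. -/
def lau (x : Ambient F A) : F[T;T⁻¹] := x.1

/-- The matrix component. -/
def mat (x : Ambient F A) : RCFMatrix F A := x.2

@[ext] theorem ext {x y : Ambient F A} (h1 : x.lau = y.lau) (h2 : x.mat = y.mat) : x = y :=
  Prod.ext h1 h2

@[simp] theorem lau_mk (l : F[T;T⁻¹]) (m : RCFMatrix F A) : (mk l m).lau = l := rfl
@[simp] theorem mat_mk (l : F[T;T⁻¹]) (m : RCFMatrix F A) : (mk l m).mat = m := rfl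
@[simp] theorem lau_zero : (0 : Ambient F A).lau = 0 := rfl
@[simp] theorem mat_zero : (0 : Ambient F A).mat = 0 := rfl
@[simp] theorem lau_add (x y : Ambient F A) : (x + y).lau = x.lau + y.lau := rfl
@[simp] theorem mat_add (x y : Ambient F A) : (x + y).mat = x.mat + y.mat := rfl
@[simp] theorem lau_sub (x y : Ambient F A) : (x - y).lau = x.lau - y.lau := rfl
@[simp] theorem mat_sub (x y : Ambient F A) : (x - y).mat = x.mat - y.mat := rfl
@[simp] theorem lau_smul (c : F) (x : Ambient F A) : (c • x).lau = c • x.lau := rfl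
@[simp] theorem mat_smul (c : F) (x : Ambient F A) : (c • x).mat = c • x.mat := rfl

/-- Multiplication: Laurent polynomials act on matrices from both sides through `toeplitz`, and
the product of the copies of two Laurent polynomials `l`, `l'` is the copy of `l * l'` corrected by
the matrix `toeplitz l * toeplitz l' - toeplitz (l * l')`, so that `t⁻¹ t = 1` and
`t t⁻¹ = 1 - 1_{0,0}` (see `tInv_mul_t` and `t_mul_tInv`). -/
instance : Mul (Ambient F A) := ⟨fun x y => mk (x.lau * y.lau)
  (toeplitz F A x.lau * y.mat + x.mat * toeplitz F A y.lau + x.mat * y.mat +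
    (toeplitz F A x.lau * toeplitz F A y.lau - toeplitz F A (x.lau * y.lau)))⟩

instance : One (Ambient F A) := ⟨mk 1 0⟩

@[simp] theorem lau_one : (1 : Ambient F A).lau = 1 := rfl
@[simp] theorem mat_one : (1 : Ambient F A).mat = 0 := rfl
@[simp] theorem lau_mul (x y : Ambient F A) : (x * y).lau = x.lau * y.lau := rfl
theorem mat_mul (x y : Ambient F A) : (x * y).mat =
    toeplitz F A x.lau * y.mat + x.mat * toeplitz F A y.lau + x.mat * y.mat +
      (toeplitz F A x.lau * toeplitz F A y.lau - toeplitz F A (x.lau * y.lau)) := rfl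

/-- The matrix by which an element acts on `M`. -/
def act (x : Ambient F A) : RCFMatrix F A := toeplitz F A x.lau + x.mat

theorem ext_act {x y : Ambient F A} (h1 : x.lau = y.lau) (h2 : x.act = y.act) : x = y := by
  refine ext h1 ?_
  rw [act, act, h1] at h2
  exact add_left_cancel h2

@[simp] theorem act_zero : (0 : Ambient F A).act = 0 := by simp [act]
@[simp] theorem act_add (x y : Ambient F A) : (x + y).act = x.act + y.act := by
  simp only [act, lau_add, mat_add, map_add]
  abel
@[simp] theorem act_smul (c : F) (x : Ambient F A) : (c • x).act = c • x.act := by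
  simp [act]
@[simp] theorem act_one : (1 : Ambient F A).act = 1 := by simp [act]
@[simp] theorem act_mul (x y : Ambient F A) : (x * y).act = x.act * y.act := by
  simp only [act, lau_mul, mat_mul, add_mul, mul_add]
  abel

instance : Ring (Ambient F A) where
  __ := (inferInstance : AddCommGroup (Ambient F A))
  left_distrib a b c := ext_act (by simp [mul_add]) (by simp [mul_add])
  right_distrib a b c := ext_act (by simp [add_mul]) (by simp [add_mul])
  zero_mul a := ext_act (by simp) (by simp)
  mul_zero a := ext_act (by simp) (by simp)
  mul_assoc a b c := ext_act (by simp [mul_assoc]) (by simp [mul_assoc])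
  one_mul a := ext_act (by simp) (by simp)
  mul_one a := ext_act (by simp) (by simp)

instance : Algebra F (Ambient F A) := Algebra.ofModule
  (fun c x y => ext_act (by simp) (by simp))
  (fun c x y => ext_act (by simp) (by simp))

variable (F A)

/-- The element `t`. -/
def t : Ambient F A := mk (LaurentPolynomial.T 1) 0

/-- The element `t⁻¹`, which is only a left inverse of `t`. -/
def tInv : Ambient F A := mk (LaurentPolynomial.T (-1)) 0

variable {A}

/-- The matrix `x_{i,j}` as an element of `F[t⁻¹,t] + M`. -/
def unit (i j : ℕ) (x : A) : Ambient F A := mk 0 (RCFMatrix.single F i j x)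

theorem coeff_T (n k : ℤ) :
    (LaurentPolynomial.T n : F[T;T⁻¹]).coeff k = if n = k then 1 else 0 := by
  rw [LaurentPolynomial.T, AddMonoidAlgebra.coeff_single, Finsupp.single_apply]

theorem act_t (i j : ℕ) : (t F A).act.entry i j = if i = j + 1 then 1 else 0 := by
  simp only [act, t, lau_mk, mat_mk, add_zero, entry_toeplitz, coeff_T]
  split_ifs <;> first | lia | simp

theorem act_tInv (i j : ℕ) : (tInv F A).act.entry i j = if j = i + 1 then 1 else 0 := by
  simp only [act, tInv, lau_mk, mat_mk, add_zero, entry_toeplitz, coeff_T]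
  split_ifs <;> first | lia | simp

theorem act_t_mul (x : Ambient F A) (i j : ℕ) :
    (t F A * x).act.entry (i + 1) j = x.act.entry i j ∧ (t F A * x).act.entry 0 j = 0 := by
  have h (k : ℕ) : (t F A * x).act.entry k j =
      ∑ l ∈ {k - 1}, (t F A).act.entry k l * x.act.entry l j := by
    rw [act_mul]
    refine RCFMatrix.entry_mul_eq_sum_left _ _ _ _ _ fun l hl => ?_
    rw [act_t] at hl
    rw [Finset.mem_singleton]
    grind
  refine ⟨?_, ?_⟩ <;> simp [-act_mul, h, act_t]

theorem act_tInv_mul (x : Ambient F A) (i j : ℕ) :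
    (tInv F A * x).act.entry i j = x.act.entry (i + 1) j := by
  have h : (tInv F A * x).act.entry i j =
      ∑ l ∈ {i + 1}, (tInv F A).act.entry i l * x.act.entry l j := by
    rw [act_mul]
    refine RCFMatrix.entry_mul_eq_sum_left _ _ _ _ _ fun l hl => ?_
    rw [act_tInv] at hl
    rw [Finset.mem_singleton]
    grind
  simp [-act_mul, h, act_tInv]

theorem act_mul_tInv (x : Ambient F A) (i j : ℕ) :
    (x * tInv F A).act.entry i (j + 1) = x.act.entry i j ∧
      (x * tInv F A).act.entry i 0 = 0 := by
  have h (k : ℕ) : (x * tInv F A).act.entry i k =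
      ∑ l ∈ {k - 1}, x.act.entry i l * (tInv F A).act.entry l k := by
    rw [act_mul]
    refine RCFMatrix.entry_mul_eq_sum_right _ _ _ _ _ fun l hl => ?_
    rw [act_tInv] at hl
    rw [Finset.mem_singleton]
    grind
  refine ⟨?_, ?_⟩ <;> simp [-act_mul, h, act_tInv]

theorem act_mul_t (x : Ambient F A) (i j : ℕ) :
    (x * t F A).act.entry i j = x.act.entry i (j + 1) := by
  have h : (x * t F A).act.entry i j =
      ∑ l ∈ {j + 1}, x.act.entry i l * (t F A).act.entry l j := by
    rw [act_mul]
    refine RCFMatrix.entry_mul_eq_sum_right _ _ _ _ _ fun l hl => ?_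
    rw [act_t] at hl
    rw [Finset.mem_singleton]
    grind
  simp [-act_mul, h, act_t]

theorem tInv_mul_t : tInv F A * t F A = 1 := by
  refine ext_act ((LaurentPolynomial.T_add (-1) 1).symm.trans LaurentPolynomial.T_zero) ?_
  ext i j
  rw [act_mul_t, act_one, act_tInv, RCFMatrix.entry_one, Matrix.one_apply]
  grind

theorem act_unit (i j : ℕ) (x : A) (k l : ℕ) :
    (unit F i j x).act.entry k l = if i = k ∧ j = l then x else 0 := by
  simp only [act, unit, lau_mk, map_zero, zero_add, mat_mk]
  exact Matrix.single_apply ..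

theorem t_mul_tInv : t F A * tInv F A = 1 - unit F 0 0 1 := by
  rw [eq_sub_iff_add_eq]
  refine ext_act ((add_zero _).trans
    ((LaurentPolynomial.T_add 1 (-1)).symm.trans LaurentPolynomial.T_zero)) ?_
  ext i j
  rw [act_one, act_add, RCFMatrix.entry_add, act_unit, RCFMatrix.entry_one, Matrix.one_apply]
  cases i with
  | zero => simp [-act_mul, (act_t_mul F _ 0 j).2]
  | succ i =>
    rw [(act_t_mul F _ i j).1, act_tInv]
    grind

theorem t_mul_unit (i j : ℕ) (x : A) : t F A * unit F i j x = unit F (i + 1) j x := by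
  refine ext_act (by simp [unit]) ?_
  ext k l
  cases k with
  | zero => simp [-act_mul, (act_t_mul F _ 0 l).2, act_unit]
  | succ k => simp [-act_mul, (act_t_mul F _ k l).1, act_unit]

theorem tInv_mul_unit_succ (i j : ℕ) (x : A) :
    tInv F A * unit F (i + 1) j x = unit F i j x := by
  refine ext_act (by simp [unit]) ?_
  ext k l
  simp [-act_mul, act_tInv_mul, act_unit]

theorem tInv_mul_unit_zero (j : ℕ) (x : A) : tInv F A * unit F 0 j x = 0 := by
  refine ext_act (by simp [unit]) ?_
  ext k l
  simp [-act_mul, act_tInv_mul, act_unit]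

theorem unit_succ_mul_t (i j : ℕ) (x : A) : unit F i (j + 1) x * t F A = unit F i j x := by
  refine ext_act (by simp [unit]) ?_
  ext k l
  simp [-act_mul, act_mul_t, act_unit]

theorem unit_zero_mul_t (i : ℕ) (x : A) : unit F i 0 x * t F A = 0 := by
  refine ext_act (by simp [unit]) ?_
  ext k l
  simp [-act_mul, act_mul_t, act_unit]

theorem unit_mul_tInv (i j : ℕ) (x : A) : unit F i j x * tInv F A = unit F i (j + 1) x := by
  refine ext_act (by simp [unit]) ?_
  ext k l
  cases l with
  | zero => simp [-act_mul, (act_mul_tInv F _ k 0).2, act_unit]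
  | succ l => simp [-act_mul, (act_mul_tInv F _ k l).1, act_unit]

end Ambient

variable {A}

/-- The algebra `B ⊆ F[t⁻¹,t] + M` generated by `t`, `t⁻¹`, the diagonal matrix
`∑ i, (a i)_{i,i}` and `1_{0,0}`. -/
def affinization (a : ℕ → A) : Subalgebra F (Ambient F A) :=
  Algebra.adjoin F
    {Ambient.t F A, Ambient.tInv F A, Ambient.mk 0 (RCFMatrix.diagonal F a), Ambient.unit F 0 0 1}

end Ambient

/-! ### Radicals and the coefficient algebras -/

/-- The Jacobson radical of a ring possibly without `1`: the set of all `x` such that the left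
ideal `R x` consists of quasi-regular elements. -/
def nonUnitalJacobson (R : Type*) [NonUnitalRing R] : Set R :=
  {x | ∀ y : R, IsQuasiregular (y * x)}

/-- The subalgebra `F·1 + A₀`. -/
def addOne {F R : Type*} [Field F] [CommRing R] [Algebra F R] (A₀ : NonUnitalSubalgebra F R) :
    Subalgebra F R where
  carrier := {r | ∃ c : F, ∃ x ∈ A₀, r = algebraMap F R c + x}
  algebraMap_mem' c := ⟨c, 0, zero_mem _, by simp⟩
  add_mem' := by
    rintro _ _ ⟨c, x, hx, rfl⟩ ⟨d, y, hy, rfl⟩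
    exact ⟨c + d, x + y, add_mem hx hy, by rw [map_add]; ring⟩
  mul_mem' := by
    rintro _ _ ⟨c, x, hx, rfl⟩ ⟨d, y, hy, rfl⟩
    refine ⟨c * d, c • y + d • x + x * y,
      add_mem (add_mem (A₀.smul_mem' c hy) (A₀.smul_mem' d hx)) (mul_mem hx hy), ?_⟩
    rw [map_mul, Algebra.smul_def, Algebra.smul_def]
    ring

/-- The subalgebra `{f/g | f(0) = 0, g(0) = 1}` of the field of rational functions. -/
def ratRadical (F : Type*) [Field F] : NonUnitalSubalgebra F (RatFunc F) where
  carrier := {r | ∃ f g : F[X], f.eval 0 = 0 ∧ g.eval 0 = 1 ∧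
    r = algebraMap F[X] (RatFunc F) f / algebraMap F[X] (RatFunc F) g}
  zero_mem' := ⟨0, 1, by simp, by simp, by simp⟩
  add_mem' := by
    rintro _ _ ⟨f, g, hf, hg, rfl⟩ ⟨f', g', hf', hg', rfl⟩
    have h : algebraMap F[X] (RatFunc F) g ≠ 0 :=
      RatFunc.algebraMap_ne_zero (by rintro rfl; simp at hg)
    have h' : algebraMap F[X] (RatFunc F) g' ≠ 0 :=
      RatFunc.algebraMap_ne_zero (by rintro rfl; simp at hg')
    refine ⟨f * g' + g * f', g * g', by simp [hf, hf'], by simp [hg, hg'], ?_⟩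
    rw [div_add_div _ _ h h']
    simp
  mul_mem' := by
    rintro _ _ ⟨f, g, hf, hg, rfl⟩ ⟨f', g', hf', hg', rfl⟩
    refine ⟨f * f', g * g', by simp [hf], by simp [hg, hg'], ?_⟩
    rw [div_mul_div_comm]
    simp
  smul_mem' := by
    rintro c _ ⟨f, g, hf, hg, rfl⟩
    refine ⟨c • f, g, by simp [hf], hg, ?_⟩
    rw [← smul_div_assoc]
    congr 1
    simp [Algebra.smul_def]

end LoopWreath

end

/-! Write `e = 1_{0,0}`. Shifting `e` on the left by `t` and on the right by `t⁻¹` gives every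
matrix unit `1_{i,j}` in `B`. Compressing the diagonal generator `D` by `1_{0,n} D 1_{n,0} =
(a_n)_{0,0}` isolates each generator in the corner. Since `x ↦ x_{0,0}` is linear and
multiplicative, the corner contains all of `A`, so shifts and finite sums give all finitary matrices
(`mk_zero_mem`). Powers of `t` and `t⁻¹` supply the Laurent part (`mk_mem`).

For the radical, the finitary matrices over `A₀` form a left ideal of `B`: elements of the ambient
algebra act by column-finite matrices with entries in `A`, and `A₀` is an ideal of `A`. Every member
`m` is left quasi-regular. Indeed `m` is a finite square block `M` padded by zeros, and `det (1 + M)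
≡ 1` modulo `A₀`. As `A₀` is its own radical, `1 + A₀` consists of units of `A`, so `1 + M` is
invertible. A left ideal of left quasi-regular elements lies in the Jacobson radical
(`mk_zero_mem_jacobson`).

The radical is not nil because it contains `x_{0,0}` for a nonzero `x ∈ A₀`, and `A₀` is a domain.
For rational functions, `-f/(f+g)` is the quasi-inverse of `f/g`, so the general statement applies.
-/

namespace LoopWreath

/-! ### Finitary matrices -/

namespace RCFMatrix

variable {F A : Type*} [Field F] [Ring A] [Algebra F A]

variable (F A) in
/-- The `(i, j)` entry, as a linear map. -/
noncomputable def entryHom (i j : ℕ) : RCFMatrix F A →ₗ[F] A where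
  toFun m := m.entry i j
  map_add' _ _ := rfl
  map_smul' _ _ := rfl

theorem entry_single (i j : ℕ) (x : A) (k l : ℕ) :
    (single F i j x).entry k l = if i = k ∧ j = l then x else 0 :=
  Matrix.single_apply ..

theorem entry_diagonal (a : ℕ → A) (i j : ℕ) :
    (diagonal F a).entry i j = if i = j then a i else 0 :=
  Matrix.diagonal_apply ..

theorem single_mul_single (i j l : ℕ) (x y : A) :
    single F i j x * single F j l y = single F i l (x * y) := by
  ext k n
  rw [entry_mul_eq_sum_left _ _ k n {j} (by intro p; rw [entry_single]; grind)]
  simp only [Finset.sum_singleton, entry_single]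
  split_ifs <;> grind

theorem single_mul_diagonal (i j : ℕ) (x : A) (a : ℕ → A) :
    single F i j x * diagonal F a = single F i j (x * a j) := by
  ext k n
  rw [entry_mul_eq_sum_left _ _ k n {j} (by intro p; rw [entry_single]; grind)]
  simp only [Finset.sum_singleton, entry_single, entry_diagonal]
  split_ifs <;> grind

theorem isFinitary_of_forall {m : RCFMatrix F A} {N : ℕ}
    (h : ∀ i j, m.entry i j ≠ 0 → i < N ∧ j < N) : m.IsFinitary :=
  ((Set.finite_Iio N).prod (Set.finite_Iio N)).subset fun p hp => h p.1 p.2 hp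

theorem IsFinitary.exists_bound {m : RCFMatrix F A} (hm : m.IsFinitary) :
    ∃ N, ∀ i j, m.entry i j ≠ 0 → i < N ∧ j < N := by
  obtain ⟨b, hb⟩ := hm.bddAbove
  refine ⟨max b.1 b.2 + 1, fun i j hij => ?_⟩
  have := hb (show (i, j) ∈ _ from hij)
  rw [Prod.le_def] at this
  exact ⟨Nat.lt_succ_of_le (this.1.trans (le_max_left _ _)),
    Nat.lt_succ_of_le (this.2.trans (le_max_right _ _))⟩

theorem isFinitary_single (i j : ℕ) (x : A) : (single F i j x).IsFinitary :=
  (Set.finite_singleton (i, j)).subset fun p hp => by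
    by_contra hc
    refine hp ?_
    rw [entry_single, if_neg]
    rintro ⟨rfl, rfl⟩
    exact hc rfl

/-- A nonzero entry of `m` at `(j, k)` can only contribute to column `k`, in rows where column `j`
of `p` is nonzero, and these are finite in number. -/
theorem IsFinitary.mul_left {m : RCFMatrix F A} (hm : m.IsFinitary) (p : RCFMatrix F A) :
    (p * m).IsFinitary := by
  refine (hm.biUnion (t := fun q => {i | p.entry i q.1 ≠ 0} ×ˢ {q.2}) fun q _ =>
    (p.col_finite q.1).prod (Set.finite_singleton _)).subset ?_
  rintro ⟨i, k⟩ hik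
  change (p * m).entry i k ≠ 0 at hik
  rw [entry_mul] at hik
  obtain ⟨j, -, hne⟩ := Finset.exists_ne_zero_of_sum_ne_zero hik
  simp only [Set.mem_iUnion]
  exact ⟨(j, k), right_ne_zero_of_mul hne, left_ne_zero_of_mul hne, rfl⟩

theorem eq_sum_single {m : RCFMatrix F A} {N : ℕ}
    (h : ∀ i j, m.entry i j ≠ 0 → i < N ∧ j < N) :
    m = ∑ i ∈ Finset.range N, ∑ j ∈ Finset.range N, single F i j (m.entry i j) := by
  ext k l
  -- Taking an entry is viewed as a linear map so that it passes through the sums.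
  change _ = entryHom F A k l _
  simp only [map_sum]
  change _ = ∑ i ∈ Finset.range N, ∑ j ∈ Finset.range N, (single F i j (m.entry i j)).entry k l
  simp only [entry_single, ite_and]
  by_cases hkl : m.entry k l = 0
  · rw [hkl]
    symm
    refine Finset.sum_eq_zero fun i _ => Finset.sum_eq_zero fun j _ => ?_
    split_ifs with h1 h2
    · rw [h1, h2, hkl]
    · rfl
    · rfl
  · obtain ⟨hk, hl⟩ := h k l hkl
    rw [Finset.sum_eq_single_of_mem k (Finset.mem_range.2 hk)
      fun i _ hi => by simp [hi],
      Finset.sum_eq_single_of_mem l (Finset.mem_range.2 hl) fun j _ hj => by simp [hj]]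
    simp

variable (F) in
/-- Extension of a finite square matrix by zeros. -/
noncomputable def ofFin {N : ℕ} (M : Matrix (Fin N) (Fin N) A) : RCFMatrix F A :=
  ∑ i : Fin N, ∑ j : Fin N, single F i j (M i j)

theorem entry_ofFin {N : ℕ} (M : Matrix (Fin N) (Fin N) A) (k l : ℕ) :
    (ofFin F M).entry k l = if h : k < N ∧ l < N then M ⟨k, h.1⟩ ⟨l, h.2⟩ else 0 := by
  change entryHom F A k l _ = _
  simp only [ofFin, map_sum]
  change ∑ i : Fin N, ∑ j : Fin N, (single F (i : ℕ) j (M i j)).entry k l = _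
  simp only [entry_single]
  split_ifs with h
  · refine (Finset.sum_eq_single_of_mem ⟨k, h.1⟩ (Finset.mem_univ _)
      fun i _ hi => Finset.sum_eq_zero fun j _ => if_neg fun hc => hi (Fin.ext hc.1)).trans ?_
    refine (Finset.sum_eq_single_of_mem ⟨l, h.2⟩ (Finset.mem_univ _)
      fun j _ hj => if_neg fun hc => hj (Fin.ext hc.2)).trans ?_
    simp
  · refine Finset.sum_eq_zero fun i _ => Finset.sum_eq_zero fun j _ => if_neg ?_
    rintro ⟨rfl, rfl⟩
    exact h ⟨i.2, j.2⟩

theorem ofFin_bound {N : ℕ} (M : Matrix (Fin N) (Fin N) A) (i j : ℕ)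
    (h : (ofFin F M).entry i j ≠ 0) : i < N ∧ j < N := by
  by_contra hc
  exact h (by rw [entry_ofFin, dif_neg hc])

theorem ofFin_zero {N : ℕ} : ofFin F (0 : Matrix (Fin N) (Fin N) A) = 0 := by
  ext k l
  simp [entry_ofFin]

theorem ofFin_add {N : ℕ} (M P : Matrix (Fin N) (Fin N) A) :
    ofFin F (M + P) = ofFin F M + ofFin F P := by
  ext k l
  simp only [entry_ofFin, entry_add]
  split_ifs <;> simp

theorem ofFin_mul {N : ℕ} (M P : Matrix (Fin N) (Fin N) A) :
    ofFin F (M * P) = ofFin F M * ofFin F P := by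
  ext k l
  rw [entry_mul_eq_sum_left _ _ k l (Finset.range N)
    fun j hj => Finset.mem_range.2 (ofFin_bound M _ _ hj).2, Finset.sum_range]
  simp only [entry_ofFin]
  by_cases hk : k < N <;> by_cases hl : l < N <;> simp [hk, hl, Matrix.mul_apply]

theorem ofFin_entry {m : RCFMatrix F A} {N : ℕ}
    (h : ∀ i j, m.entry i j ≠ 0 → i < N ∧ j < N) :
    ofFin F (Matrix.of fun i j : Fin N => m.entry i j) = m := by
  ext k l
  rw [entry_ofFin]
  split_ifs with hc
  · rfl
  · by_contra hne
    exact hc (h k l (Ne.symm hne))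

/-- A finitary matrix with entries in an ideal contained in the Jacobson radical of a commutative
ring is left quasi-regular within the finitary matrices. -/
theorem IsFinitary.exists_quasiInverse {A : Type*} [CommRing A] [Algebra F A] {I : Ideal A}
    (hI : ∀ x ∈ I, IsUnit (1 + x)) {m : RCFMatrix F A} (hm : m.IsFinitary)
    (hmI : ∀ i j, m.entry i j ∈ I) :
    ∃ z : RCFMatrix F A, z.IsFinitary ∧ z + m + z * m = 0 := by
  obtain ⟨N, hN⟩ := hm.exists_bound
  set M : Matrix (Fin N) (Fin N) A := Matrix.of fun i j => m.entry i j with hM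
  have hdet : IsUnit (1 + M).det := by
    -- Modulo `I` the block `M` vanishes and the determinant becomes that of the identity.
    have h1 : (1 + M).det - 1 ∈ I := by
      rw [← Ideal.Quotient.eq_zero_iff_mem, map_sub, map_one, RingHom.map_det, map_add, map_one]
      have : (Ideal.Quotient.mk I).mapMatrix M = 0 := by
        ext i j
        exact Ideal.Quotient.eq_zero_iff_mem.2 (hmI i j)
      rw [this, add_zero, Matrix.det_one, sub_self]
    simpa using hI _ h1
  -- Padding by zeros respects sums and products but not `1`, so what is transferred is the identity
  -- `z + m + z * m = 0`, which does not mention `1`.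
  refine ⟨ofFin F ((1 + M)⁻¹ - 1), isFinitary_of_forall (ofFin_bound _), ?_⟩
  conv_lhs => rw [← ofFin_entry hN]
  rw [← hM, ← ofFin_mul, ← ofFin_add, ← ofFin_add, ← ofFin_zero (N := N)]
  congr 1
  have h := Matrix.nonsing_inv_mul (1 + M) hdet
  rw [mul_add, mul_one] at h
  rw [sub_mul, one_mul, ← sub_eq_zero.2 h]
  abel

end RCFMatrix

/-! ### Elements of the affinization -/

namespace Ambient

open RCFMatrix

variable {F A : Type*} [Field F] [Ring A] [Algebra F A]

variable (F A) in
/-- The inclusion of the matrices, as a linear map. -/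
noncomputable def matHom : RCFMatrix F A →ₗ[F] Ambient F A where
  toFun m := mk 0 m
  map_add' _ _ := ext (by simp) rfl
  map_smul' _ _ := ext (by simp) rfl

theorem matHom_apply (m : RCFMatrix F A) : matHom F A m = mk 0 m := rfl

theorem act_mk_zero (m : RCFMatrix F A) : (mk 0 m).act = m := by
  simp [act]

theorem mul_mk_zero (x : Ambient F A) (m : RCFMatrix F A) : x * mk 0 m = mk 0 (x.act * m) :=
  ext_act (by simp) (by rw [act_mul, act_mk_zero, act_mk_zero])

theorem mk_zero_mul_mk_zero (m n : RCFMatrix F A) :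
    mk 0 m * mk 0 n = (mk 0 (m * n) : Ambient F A) := by
  rw [mul_mk_zero, act_mk_zero]

theorem unit_mul_unit (i j l : ℕ) (x y : A) :
    unit F i j x * unit F j l y = unit F i l (x * y) := by
  rw [unit, unit, mk_zero_mul_mk_zero, single_mul_single, unit]

/-! ### Matrix units and finitary matrices in `B`. -/

theorem t_mem (a : ℕ → A) : t F A ∈ affinization F a :=
  Algebra.subset_adjoin (by simp)

theorem tInv_mem (a : ℕ → A) : tInv F A ∈ affinization F a :=
  Algebra.subset_adjoin (by simp)

theorem diagonal_mem (a : ℕ → A) : mk 0 (RCFMatrix.diagonal F a) ∈ affinization F a :=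
  Algebra.subset_adjoin (by simp)

theorem unit_zero_zero_one_mem (a : ℕ → A) : unit F 0 0 1 ∈ affinization F a :=
  Algebra.subset_adjoin (by simp)

theorem unit_mem_of_unit_zero_zero_mem {a : ℕ → A} {x : A} (h : unit F 0 0 x ∈ affinization F a)
    (i j : ℕ) : unit F i j x ∈ affinization F a := by
  induction i with
  | zero =>
    induction j with
    | zero => exact h
    | succ j ih => rw [← unit_mul_tInv]; exact mul_mem ih (tInv_mem a)
  | succ i ih => rw [← t_mul_unit]; exact mul_mem (t_mem a) ih

/-- Sandwiching the diagonal generator between `1_{0,n}` and `1_{n,0}` picks out its `n`-th entry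
and moves it to the corner. -/
theorem unit_zero_zero_generator_mem (a : ℕ → A) (n : ℕ) :
    unit F 0 0 (a n) ∈ affinization F a := by
  have h0 := unit_mem_of_unit_zero_zero_mem (unit_zero_zero_one_mem a) (F := F)
  have h1 : unit F 0 n 1 * mk 0 (RCFMatrix.diagonal F a) * unit F n 0 1 = unit F 0 0 (a n) := by
    rw [unit, mk_zero_mul_mk_zero, single_mul_diagonal, one_mul]
    change unit F 0 n (a n) * unit F n 0 1 = _
    rw [unit_mul_unit, mul_one]
  rw [← h1]
  exact mul_mem (mul_mem (h0 _ _) (diagonal_mem a)) (h0 _ _)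

theorem unit_add (i j : ℕ) (x y : A) : unit F i j (x + y) = unit F i j x + unit F i j y :=
  ext_act (by simp [unit]) (by
    ext k l
    rw [act_add, entry_add, act_unit, act_unit, act_unit]
    split_ifs <;> simp)

theorem unit_smul (i j : ℕ) (c : F) (x : A) : unit F i j (c • x) = c • unit F i j x :=
  ext_act (by simp [unit]) (by
    ext k l
    rw [act_smul, entry_smul, act_unit, act_unit]
    split_ifs <;> simp)

/-- The elements `x` with `x_{0,0} ∈ B` form a subalgebra of `A` containing every generator. Scalars
go to multiples of `1_{0,0}`, not of `1`, which is why `1_{0,0}` is needed in `B`. -/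
theorem unit_mem {a : ℕ → A} (ha : Algebra.adjoin F (Set.range a) = ⊤) (i j : ℕ) (x : A) :
    unit F i j x ∈ affinization F a := by
  refine unit_mem_of_unit_zero_zero_mem ?_ i j
  have hx : x ∈ Algebra.adjoin F (Set.range a) := ha ▸ Algebra.mem_top
  induction hx using Algebra.adjoin_induction with
  | mem x hx =>
    obtain ⟨n, rfl⟩ := hx
    exact unit_zero_zero_generator_mem a n
  | algebraMap c =>
    rw [Algebra.algebraMap_eq_smul_one, unit_smul]
    exact Subalgebra.smul_mem _ (unit_zero_zero_one_mem a) c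
  | add x y _ _ hx hy => rw [unit_add]; exact add_mem hx hy
  | mul x y _ _ hx hy => rw [← unit_mul_unit]; exact mul_mem hx hy

theorem mk_zero_mem {a : ℕ → A} (ha : Algebra.adjoin F (Set.range a) = ⊤) {m : RCFMatrix F A}
    (hm : m.IsFinitary) : mk 0 m ∈ affinization F a := by
  obtain ⟨N, hN⟩ := hm.exists_bound
  rw [eq_sum_single hN, ← matHom_apply]
  simp only [map_sum]
  exact sum_mem fun i _ => sum_mem fun j _ => unit_mem ha i j _

/-! ### Laurent polynomials in `B`. -/

theorem entry_act_mk_T (n : ℤ) (i j : ℕ) :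
    (mk (LaurentPolynomial.T n) 0 : Ambient F A).act.entry i j =
      if n = (i : ℤ) - j then 1 else 0 := by
  simp only [act, lau_mk, mat_mk, add_zero, entry_toeplitz, coeff_T]
  split_ifs <;> simp

/-- Products of Laurent polynomials carry a matrix correction in general, as `t t⁻¹ ≠ 1`. For powers
of `t` alone it vanishes: shifting the Toeplitz matrix of `tⁿ` down one row, with a zero row on top,
gives exactly that of `tⁿ⁺¹`. -/
theorem t_pow (n : ℕ) : t F A ^ n = mk (LaurentPolynomial.T n) 0 := by
  induction n with
  | zero => rw [pow_zero, Nat.cast_zero, LaurentPolynomial.T_zero]; rfl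
  | succ n ih =>
    rw [pow_succ', ih]
    refine ext_act ?_ ?_
    · rw [Nat.cast_succ, add_comm (n : ℤ) 1]; exact (LaurentPolynomial.T_add _ _).symm
    · ext i j
      cases i with
      | zero =>
        rw [(act_t_mul F _ 0 j).2, entry_act_mk_T, if_neg (by lia)]
      | succ i =>
        rw [(act_t_mul F _ i j).1, entry_act_mk_T, entry_act_mk_T]
        congr 1
        simp only [eq_iff_iff]
        lia

theorem tInv_pow (n : ℕ) : tInv F A ^ n = mk (LaurentPolynomial.T (-n)) 0 := by
  induction n with
  | zero => rw [pow_zero, Nat.cast_zero, neg_zero, LaurentPolynomial.T_zero]; rfl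
  | succ n ih =>
    -- Here the new factor goes on the right: `t⁻¹` then shifts columns and inserts a zero column,
    -- which mirrors the case of `t`.
    rw [pow_succ, ih]
    refine ext_act ?_ ?_
    · rw [Nat.cast_succ, neg_add]; exact (LaurentPolynomial.T_add _ _).symm
    · ext i j
      cases j with
      | zero =>
        rw [(act_mul_tInv F _ i 0).2, entry_act_mk_T, if_neg (by lia)]
      | succ j =>
        rw [(act_mul_tInv F _ i j).1, entry_act_mk_T, entry_act_mk_T]
        congr 1
        simp only [eq_iff_iff]
        lia

theorem mk_T_mem (a : ℕ → A) (n : ℤ) :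
    mk (LaurentPolynomial.T n) 0 ∈ affinization F a := by
  obtain ⟨k, rfl | rfl⟩ := n.eq_nat_or_neg
  · rw [← t_pow]; exact pow_mem (t_mem a) k
  · rw [← tInv_pow]; exact pow_mem (tInv_mem a) k

theorem mk_laurent_mem (a : ℕ → A) (l : F[T;T⁻¹]) : mk l 0 ∈ affinization F a := by
  induction l using LaurentPolynomial.induction_on' with
  | add p q hp hq =>
    convert! add_mem hp hq using 1
    exact ext rfl (add_zero _).symm
  | C_mul_T n c =>
    convert! Subalgebra.smul_mem _ (mk_T_mem a n) c using 1
    refine ext ?_ (smul_zero _).symm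
    rw [lau_smul, lau_mk, lau_mk, LaurentPolynomial.smul_eq_C_mul]

theorem mk_mem {a : ℕ → A} (ha : Algebra.adjoin F (Set.range a) = ⊤) (l : F[T;T⁻¹])
    {m : RCFMatrix F A} (hm : m.IsFinitary) : mk l m ∈ affinization F a := by
  convert! add_mem (mk_laurent_mem a l) (mk_zero_mem ha hm) using 1
  exact ext (add_zero _).symm (zero_add _).symm

theorem finiteType_affinization (a : ℕ → A) : Algebra.FiniteType F (affinization F a) :=
  (Subalgebra.fg_iff_finiteType _).1
    (Subalgebra.fg_def.2 ⟨_, Set.toFinite _, rfl⟩)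

/-- Finitary matrices with entries in an ideal contained in the Jacobson radical of the coefficient
algebra lie in the Jacobson radical of the affinization. -/
theorem mk_zero_mem_jacobson {A : Type*} [CommRing A] [Algebra F A] {I : Ideal A}
    (hI : ∀ x ∈ I, IsUnit (1 + x)) {a : ℕ → A} (ha : Algebra.adjoin F (Set.range a) = ⊤)
    {m : RCFMatrix F A} (hm : m.IsFinitary) (hmI : ∀ i j, m.entry i j ∈ I) :
    (⟨mk 0 m, mk_zero_mem ha hm⟩ : affinization F a) ∈ Ring.jacobson (affinization F a) := by
  rw [← Ideal.jacobson_bot, Ideal.mem_jacobson_iff]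
  rintro ⟨y, hy⟩
  -- Although `y` need not be finitary, `y * m` is a finitary matrix, again with entries in `I`.
  have hmul : (y.act * m).IsFinitary := hm.mul_left _
  obtain ⟨z, hz, hzm⟩ := hmul.exists_quasiInverse hI (fun i k => by
    rw [entry_mul]
    exact sum_mem fun j _ => I.mul_mem_left _ (hmI j k))
  -- The criterion asks for a left inverse of `1 + y * m`. Since the quasi-inverse `z` is finitary,
  -- `1 + z` lies in `B`.
  refine ⟨1 + ⟨mk 0 z, mk_zero_mem ha hz⟩, ?_⟩
  rw [Ideal.mem_bot]
  ext1
  change (1 + mk 0 z) * y * mk 0 m + (1 + mk 0 z) - 1 = 0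
  have h : mk 0 z + mk 0 (y.act * m) + mk 0 z * mk 0 (y.act * m) = (0 : Ambient F A) := by
    rw [mk_zero_mul_mk_zero, ← matHom_apply, ← matHom_apply, ← matHom_apply, ← map_add,
      ← map_add, hzm, map_zero]
  rw [mul_assoc, mul_mk_zero, ← h, add_mul, one_mul]
  abel

end Ambient

/-! ### Coefficient algebras -/

section AddOne

variable {F R : Type*} [Field F] [CommRing R] [Algebra F R]

/-- `A₀` as an ideal of `F·1 + A₀`. -/
noncomputable def addOneIdeal (A₀ : NonUnitalSubalgebra F R) : Ideal (addOne A₀) where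
  carrier := {x | (x : R) ∈ A₀}
  zero_mem' := zero_mem A₀
  add_mem' hx hy := add_mem (S := NonUnitalSubalgebra F R) (s := A₀) hx hy
  smul_mem' := by
    rintro ⟨_, c, x, hx, rfl⟩ ⟨y, _⟩ hy
    change (algebraMap F R c + x) * y ∈ A₀
    rw [add_mul, ← Algebra.smul_def]
    exact add_mem (A₀.smul_mem' c hy) (mul_mem hx hy)

theorem le_addOne {A₀ : NonUnitalSubalgebra F R} {x : R} (hx : x ∈ A₀) : x ∈ addOne A₀ :=
  ⟨0, x, hx, by simp⟩

/-- The radical condition only speaks of multiples `y * x` with `y ∈ A₀`, and `A₀` may lack a unit.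
Taking `y = -x` makes `1 - x² = (1 + x)(1 - x)` invertible, hence also its factor `1 + x`. -/
theorem isUnit_one_add_of_mem {A₀ : NonUnitalSubalgebra F R}
    (hJ : nonUnitalJacobson A₀ = Set.univ) (x : addOne A₀) (hx : x ∈ addOneIdeal A₀) :
    IsUnit (1 + x) := by
  have h : (⟨x, hx⟩ : A₀) ∈ nonUnitalJacobson A₀ := hJ ▸ Set.mem_univ _
  obtain ⟨y, -, hy⟩ := isQuasiregular_iff.1 (h (-⟨x, hx⟩))
  have hy' : -(x : R) * x + y + y * (-x * x) = 0 := congrArg Subtype.val hy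
  refine IsUnit.of_mul_eq_one ((1 - x) * (1 + ⟨y, le_addOne y.2⟩)) ?_
  ext1
  change (1 + (x : R)) * ((1 - x) * (1 + y)) = 1
  linear_combination hy'

/-- `R` itself may have zero divisors, so the positive powers of `x` are followed inside `A₀`, where
nonzero elements have nonzero products. -/
theorem exists_not_isNilpotent {A₀ : NonUnitalSubalgebra F R} [Nontrivial A₀] [NoZeroDivisors A₀] :
    ∃ x : R, x ∈ A₀ ∧ ¬ IsNilpotent x := by
  obtain ⟨x, hx⟩ := exists_ne (0 : A₀)
  refine ⟨x, x.2, ?_⟩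
  have key : ∀ n : ℕ, ∃ y : A₀, y ≠ 0 ∧ (x : R) ^ (n + 1) = y := by
    intro n
    induction n with
    | zero => exact ⟨x, hx, by simp⟩
    | succ n ih =>
      obtain ⟨y, hy, h⟩ := ih
      exact ⟨y * x, mul_ne_zero hy hx, by rw [pow_succ, h]; rfl⟩
  rintro ⟨n, hn⟩
  obtain ⟨y, hy, h⟩ := key n
  refine hy (Subtype.ext ?_)
  rw [← h, pow_succ, hn, zero_mul]
  rfl

/-- The exponent must be positive: the zeroth power on the left is `1`, not `1_{0,0}`. -/
theorem unit_zero_zero_pow {A : Type*} [Ring A] [Algebra F A] (x : A) (n : ℕ) :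
    Ambient.unit F 0 0 x ^ (n + 1) = Ambient.unit F 0 0 (x ^ (n + 1)) := by
  induction n with
  | zero => simp
  | succ n ih => rw [pow_succ, ih, Ambient.unit_mul_unit, ← pow_succ]

theorem exists_mem_jacobson_not_isNilpotent {A₀ : NonUnitalSubalgebra F R} [Nontrivial A₀]
    [NoZeroDivisors A₀] (hJ : nonUnitalJacobson A₀ = Set.univ) {a : ℕ → addOne A₀}
    (ha : Algebra.adjoin F (Set.range a) = ⊤) :
    ∃ b ∈ Ring.jacobson (affinization F a), ¬ IsNilpotent b := by
  obtain ⟨x, hx, hnil⟩ := exists_not_isNilpotent (A₀ := A₀)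
  let x' : addOne A₀ := ⟨x, le_addOne hx⟩
  refine ⟨_, Ambient.mk_zero_mem_jacobson (isUnit_one_add_of_mem hJ) ha
    (RCFMatrix.isFinitary_single 0 0 x') ?_, ?_⟩
  · intro i j
    rw [RCFMatrix.entry_single]
    split_ifs
    · exact hx
    · exact zero_mem _
  · rintro ⟨n, hn⟩
    refine hnil ⟨n + 1, ?_⟩
    have h : Ambient.unit F 0 0 x' ^ n = 0 := congrArg Subtype.val hn
    have h1 : Ambient.unit F 0 0 (x' ^ (n + 1)) = 0 := by
      rw [← unit_zero_zero_pow, pow_succ, h, zero_mul]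
    have h2 := Ambient.act_unit F 0 0 (x' ^ (n + 1)) 0 0
    rw [h1, Ambient.act_zero, RCFMatrix.entry_zero, if_pos ⟨rfl, rfl⟩] at h2
    exact (congrArg Subtype.val h2).symm

end AddOne

/-! ### The radical algebra of rational functions -/

section RatRadical

variable (F : Type*) [Field F]

theorem nontrivial_ratRadical : Nontrivial (ratRadical F) := by
  refine ⟨⟨⟨algebraMap F[X] (RatFunc F) X, X, 1, by simp, by simp, by simp⟩, 0, fun h => ?_⟩⟩
  exact RatFunc.algebraMap_ne_zero Polynomial.X_ne_zero (congrArg Subtype.val h)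

theorem noZeroDivisors_ratRadical : NoZeroDivisors (ratRadical F) where
  eq_zero_or_eq_zero_of_mul_eq_zero {x y} h :=
    (mul_eq_zero.1 (congrArg Subtype.val h : (x : RatFunc F) * y = 0)).imp Subtype.ext Subtype.ext

/-- From `1 + f/g = (f+g)/g`, the quasi-inverse is `g/(f+g) - 1 = -f/(f+g)`. It lies in `A₀` because
`f + g` takes the value `1` at `0`. -/
theorem isQuasiregular_ratRadical (x : ratRadical F) : IsQuasiregular x := by
  obtain ⟨_, f, g, hf, hg, rfl⟩ := x
  have hg0 : algebraMap F[X] (RatFunc F) g ≠ 0 :=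
    RatFunc.algebraMap_ne_zero (by rintro rfl; simp at hg)
  have hfg : (f + g).eval 0 = 1 := by simp [hf, hg]
  have hfg0 : algebraMap F[X] (RatFunc F) f + algebraMap F[X] (RatFunc F) g ≠ 0 := by
    rw [← map_add]
    exact RatFunc.algebraMap_ne_zero (by intro h; simp [h] at hfg)
  refine isQuasiregular_iff.2 ⟨⟨_, -f, f + g, by simp [hf], hfg, rfl⟩, ?_, ?_⟩ <;>
  · ext1
    simp only [NonUnitalSubalgebra.coe_add, NonUnitalSubalgebra.coe_mul,
      NonUnitalSubalgebra.coe_zero, map_neg, map_add]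
    field_simp
    ring

theorem nonUnitalJacobson_ratRadical : nonUnitalJacobson (ratRadical F) = Set.univ :=
  Set.eq_univ_of_forall fun _ _ => isQuasiregular_ratRadical F _

theorem countable_polynomial [Countable F] : Countable F[X] := by
  rw [← Cardinal.mk_le_aleph0_iff]
  exact Polynomial.cardinalMk_le_max.trans (max_le Cardinal.mk_le_aleph0 le_rfl)

theorem countable_ratFunc [Countable F] : Countable (RatFunc F) := by
  have := countable_polynomial F
  refine Function.Surjective.countable (f := fun p : F[X] × F[X] =>
    algebraMap F[X] (RatFunc F) p.1 / algebraMap F[X] (RatFunc F) p.2) fun r => ?_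
  exact ⟨(r.num, r.denom), RatFunc.num_div_denom r⟩

theorem rank_ratRadical_le [Countable F] :
    Module.rank F (ratRadical F) ≤ Cardinal.aleph0 := by
  have := countable_ratFunc F
  exact (rank_le_card F _).trans Cardinal.mk_le_aleph0

end RatRadical

end LoopWreath

theorem mainTheorem5 {F : Type*} [Field F] [Countable F] :
    (Nontrivial (LoopWreath.ratRadical F) ∧
      NoZeroDivisors (LoopWreath.ratRadical F) ∧
      LoopWreath.nonUnitalJacobson (LoopWreath.ratRadical F) = Set.univ ∧
      Module.rank F (LoopWreath.ratRadical F) ≤ Cardinal.aleph0 ∧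
      ∃ a : ℕ → LoopWreath.addOne (LoopWreath.ratRadical F),
        Algebra.adjoin F (Set.range a) = ⊤ ∧
        Algebra.FiniteType F (LoopWreath.affinization F a) ∧
        ∃ b ∈ Ring.jacobson (LoopWreath.affinization F a), ¬ IsNilpotent b) ∧
    (∀ (R : Type*) [CommRing R] [Algebra F R] (A₀ : NonUnitalSubalgebra F R),
      Nontrivial A₀ → NoZeroDivisors A₀ → LoopWreath.nonUnitalJacobson A₀ = Set.univ →
      ∀ a : ℕ → LoopWreath.addOne A₀, Algebra.adjoin F (Set.range a) = ⊤ →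
        Algebra.FiniteType F (LoopWreath.affinization F a) ∧
        (∀ (l : LaurentPolynomial F) (m : LoopWreath.RCFMatrix F (LoopWreath.addOne A₀)),
          m.IsFinitary → LoopWreath.Ambient.mk l m ∈ LoopWreath.affinization F a) ∧
        (∀ m : LoopWreath.RCFMatrix F (LoopWreath.addOne A₀),
          m.IsFinitary → (∀ i j, (m.entry i j : R) ∈ A₀) →
          ∃ b ∈ Ring.jacobson (LoopWreath.affinization F a),
            (b : LoopWreath.Ambient F (LoopWreath.addOne A₀)) = LoopWreath.Ambient.mk 0 m) ∧
        ∃ b ∈ Ring.jacobson (LoopWreath.affinization F a), ¬ IsNilpotent b) := by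
  refine ⟨⟨LoopWreath.nontrivial_ratRadical F, LoopWreath.noZeroDivisors_ratRadical F,
    LoopWreath.nonUnitalJacobson_ratRadical F, LoopWreath.rank_ratRadical_le F, ?_⟩, ?_⟩
  · have := LoopWreath.countable_ratFunc F
    have := LoopWreath.nontrivial_ratRadical F
    have := LoopWreath.noZeroDivisors_ratRadical F
    -- `A` is countable, so an enumeration of all its elements serves as the generating sequence.
    obtain ⟨a, ha⟩ := exists_surjective_nat (LoopWreath.addOne (LoopWreath.ratRadical F))
    have hgen : Algebra.adjoin F (Set.range a) = ⊤ := by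
      rw [ha.range_eq, Algebra.adjoin_univ]
    exact ⟨a, hgen, LoopWreath.Ambient.finiteType_affinization a,
      LoopWreath.exists_mem_jacobson_not_isNilpotent
        (LoopWreath.nonUnitalJacobson_ratRadical F) hgen⟩
  · intro R _ _ A₀ _ _ hJ a ha
    exact ⟨LoopWreath.Ambient.finiteType_affinization a,
      fun l m hm => LoopWreath.Ambient.mk_mem ha l hm,
      fun m hm hmA => ⟨_, LoopWreath.Ambient.mk_zero_mem_jacobson
        (LoopWreath.isUnit_one_add_of_mem hJ) ha hm hmA, rfl⟩,
      LoopWreath.exists_mem_jacobson_not_isNilpotent hJ ha⟩
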